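/- All graphs are finite, simple and undirected. For a graph $G$ and $X\subseteq V(G)$, $G[X]$ is the subgraph induced by $X$, and $\alpha(G)$ is the maximum size of an independent set of $G$. A tree decomposition of $G$ is a pair $(T,\beta)$ of a finite tree $T$ and a map $\beta\colon V(T)\to 2^{V(G)}$ such that every vertex of $G$ lies in some $\beta(t)$, for every edge $uv$ of $G$ some $\beta(t)$ contains both $u$ and $v$, and for every $v\in V(G)$ the set $\{t\in V(T) : v\in\beta(t)\}$ induces a subtree of $T$. Its independence number is $\max_{t\in V(T)}\alpha(G[\beta(t)])$, and the tree-independence number $\mathsf{tree}\text{-}\alpha(G)$ is the minimum independence number of a tree decomposition of $G$. For $p\ge 1$, let $S_p$ be the graph obtained from the claw $K_{1,3}$ by subdividing each of its edges $p-1$ times, and let $T_p$ be the line graph of $S_p$. A graph is $\{H_1,\dots,H_k\}$-free if it has no induced subgraph isomorphic to any of $H_1,\dots,H_k$. **Theorem.** Let $d\ge 2$ and $p\ge 1$ be integers and let $G$ be a $\{K_{1,d},S_p,T_p\}$-free graph. Then $$\mathsf{tree}\text{-}\alpha(G)\le 20(d-1)^4(p+1).$$ -/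

import Mathlib

namespace TreeAlpha

/-- A tree decomposition `(T, β)` of the graph `G`, where the tree `T` has node set `ι`. -/
structure TreeDecomposition {V : Type*} (G : SimpleGraph V) (ι : Type*) where
  /-- the tree `T` -/
  tree : SimpleGraph ι
  isTree : tree.IsTree
  /-- the bags `β(t)` -/
  bag : ι → Set V
  exists_mem_bag : ∀ v, ∃ t, v ∈ bag t
  exists_edge_bag : ∀ u v, G.Adj u v → ∃ t, u ∈ bag t ∧ v ∈ bag t
  /-- The nodes whose bags contain `v` induce a (nonempty) subtree: inside a tree this means that
  the subgraph they induce is connected. -/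
  connected_nodes : ∀ v, (tree.induce {t | v ∈ bag t}).Connected

/-- The independence number of a tree decomposition with finitely many nodes: the maximum over
all nodes `t` of the independence number of `G[β(t)]`. -/
noncomputable def TreeDecomposition.indepNum {V ι : Type*} {G : SimpleGraph V}
    (D : TreeDecomposition G ι) : ℕ :=
  ⨆ t, (G.induce (D.bag t)).indepNum

/-- The tree-independence number of a finite graph: the minimum of the independence numbers of
its tree decompositions (over finite trees). -/
noncomputable def treeIndepNum {V : Type*} (G : SimpleGraph V) : ℕ :=
  sInf {k | ∃ (ι : Type) (_ : Finite ι) (D : TreeDecomposition G ι), D.indepNum = k}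

/-- Transport of a tree decomposition along a bijection of the node sets. -/
def TreeDecomposition.reindex {V ι κ : Type*} {G : SimpleGraph V}
    (D : TreeDecomposition G ι) (e : κ ≃ ι) : TreeDecomposition G κ where
  tree := D.tree.comap e
  isTree := (SimpleGraph.Iso.comap e D.tree).isTree_iff.2 D.isTree
  bag t := D.bag (e t)
  exists_mem_bag v := by
    obtain ⟨t, ht⟩ := D.exists_mem_bag v
    exact ⟨e.symm t, by simpa using ht⟩
  exists_edge_bag u v h := by
    obtain ⟨t, ht⟩ := D.exists_edge_bag u v h
    exact ⟨e.symm t, by simpa using ht⟩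
  connected_nodes v := by
    refine (SimpleGraph.Iso.connected_iff ?_).2 (D.connected_nodes v)
    exact
      { toEquiv := e.subtypeEquiv (fun t => by simp)
        map_rel_iff' := by simp }

/-- The trivial tree decomposition, with one node whose bag is the whole vertex set. -/
def TreeDecomposition.trivial {V : Type*} (G : SimpleGraph V) : TreeDecomposition G Unit where
  tree := ⊥
  isTree := SimpleGraph.IsTree.of_subsingleton
  bag _ := Set.univ
  exists_mem_bag _ := ⟨(), Set.mem_univ _⟩
  exists_edge_bag _ _ _ := ⟨(), Set.mem_univ _, Set.mem_univ _⟩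
  connected_nodes v := by
    have : Nonempty {t : Unit | v ∈ (Set.univ : Set V)} := ⟨⟨(), Set.mem_univ v⟩⟩
    exact (SimpleGraph.IsTree.of_subsingleton).connected

/-- The minimum in the definition of the tree-independence number is attained. -/
theorem exists_indepNum_eq_treeIndepNum {V : Type*} (G : SimpleGraph V) :
    ∃ (ι : Type) (_ : Finite ι) (D : TreeDecomposition G ι), D.indepNum = treeIndepNum G :=
  Nat.sInf_mem (s := {k | ∃ (ι : Type) (_ : Finite ι) (D : TreeDecomposition G ι), D.indepNum = k})
    ⟨_, Unit, inferInstance, TreeDecomposition.trivial G, rfl⟩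

/-- The tree-independence number bounds from below the independence number of every tree
decomposition over a finite tree, in whatever universe its nodes live. -/
theorem treeIndepNum_le {V ι : Type*} [Finite ι] {G : SimpleGraph V}
    (D : TreeDecomposition G ι) : treeIndepNum G ≤ D.indepNum := by
  obtain ⟨n, ⟨e⟩⟩ := Finite.exists_equiv_fin ι
  refine Nat.sInf_le ⟨Fin n, inferInstance, D.reindex e.symm, ?_⟩
  exact e.symm.iSup_comp (g := fun t => (G.induce (D.bag t)).indepNum)

/-- The claw with its three edges subdivided so that they become paths of lengths
`l 0`, `l 1`, `l 2` (for positive `l i`, the `i`-th edge is subdivided `l i - 1` times).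
The vertex `none` is the centre, and `some ⟨i, j⟩` is the vertex at distance `j + 1` from the
centre on the `i`-th leg. -/
def subdividedClaw (l : Fin 3 → ℕ) : SimpleGraph (Option ((i : Fin 3) × Fin (l i))) :=
  SimpleGraph.fromRel fun x y =>
    match x, y with
    | none, some y => y.2.val = 0
    | some x, some y => x.1 = y.1 ∧ y.2.val = x.2.val + 1
    | _, none => False

/-- The graph `S_p = S_{p,p,p}`: the claw with each edge subdivided `p - 1` times. -/
abbrev graphS (p : ℕ) : SimpleGraph (Option ((_ : Fin 3) × Fin p)) :=
  subdividedClaw fun _ => p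

/-- The graph `T_p = T_{p,p,p}`: the line graph of `S_p`. -/
abbrev graphT (p : ℕ) : SimpleGraph (graphS p).edgeSet :=
  (graphS p).lineGraph

end TreeAlpha

/-! Two facts combine. First, let every finite vertex set be split evenly by deleting some set of
independence number at most `k`. Then the usual recursive construction, with independence number in
place of cardinality, gives a tree decomposition of independence number at most `5 * k`
(`hasDecomposition_of_separators`). Second, without induced `S_p` and `T_p`, closed neighbourhoods
of at most `3 * p + 1` vertices are such separators (`exists_balanced_separator`). Excluding
`K_{1,d}` bounds their independence number by `(3 * p + 1) * (d - 1)`.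

For the second fact, suppose that some `I` has no such separator. Then for every small `X` some
component of `G - N[X]` holds more than half of `I`. Two such heavy components always meet, and they
shrink as `X` grows. An induced path is pushed towards them: adding its last vertex to `X` shrinks
the component, and a vertex just lost extends the path (`Approaches.step`). To keep `X` bounded,
only the first and last `p` path vertices are retained. A vertex becomes forgettable because a
neighbour of the heavy component that sees the path only in its middle would start an induced path
of length `p` into the component, and this yields `S_p` or `T_p` (`graphS_or_graphT_of_paths`).
Hence the path grows forever, which is absurd in a finite graph (`exists_approaches`). -/

namespace TreeAlpha

open SimpleGraph

/-! ### Joining two trees by an edge -/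

section Join

variable {ι κ : Type*} {T : SimpleGraph ι} {U : SimpleGraph κ}

/-- The graph obtained from the disjoint union of `T` and `U` by joining `s` to `t`. -/
def joinGraph (T : SimpleGraph ι) (U : SimpleGraph κ) (s : ι) (t : κ) : SimpleGraph (ι ⊕ κ) :=
  (T ⊕g U) ⊔ edge (Sum.inl s) (Sum.inr t)

/-- The inclusion of the left graph into the join. -/
def joinInl (T : SimpleGraph ι) (U : SimpleGraph κ) (s : ι) (t : κ) : T →g joinGraph T U s t where
  toFun := Sum.inl
  map_rel' h := Or.inl (by simpa using h)

/-- The inclusion of the right graph into the join. -/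
def joinInr (T : SimpleGraph ι) (U : SimpleGraph κ) (s : ι) (t : κ) : U →g joinGraph T U s t where
  toFun := Sum.inr
  map_rel' h := Or.inl (by simpa using h)

theorem joinGraph_adj (T : SimpleGraph ι) (U : SimpleGraph κ) (s : ι) (t : κ) :
    (joinGraph T U s t).Adj (Sum.inl s) (Sum.inr t) :=
  Or.inr (by simp [edge_adj])

/-- No walk changes sides, so a walk avoiding a given edge projects to a walk in that edge's own
side; bridges therefore stay bridges. -/
theorem isAcyclic_sum (hT : T.IsAcyclic) (hU : U.IsAcyclic) : (T ⊕g U).IsAcyclic := by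
  rw [isAcyclic_iff_forall_adj_isBridge] at *
  have key₁ : ∀ (e₁ e₂ : ι) (x y : ι ⊕ κ),
      ((T ⊕g U) \ fromEdgeSet {s(.inl e₁, .inl e₂)}).Walk x y →
      ∀ a, x = .inl a → ∃ b, y = .inl b ∧ (T \ fromEdgeSet {s(e₁, e₂)}).Reachable a b := by
    intro e₁ e₂ x y w
    induction w with
    | nil => exact fun a h => ⟨a, h, Reachable.refl _⟩
    | @cons u v w' h p ih =>
      rintro a rfl
      rcases v with v | v
      · obtain ⟨b, hb, hr⟩ := ih v rfl
        refine ⟨b, hb, Reachable.trans (Adj.reachable ?_) hr⟩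
        simpa [sdiff_adj] using h
      · simp [sdiff_adj] at h
  have key₂ : ∀ (e₁ e₂ : κ) (x y : ι ⊕ κ),
      ((T ⊕g U) \ fromEdgeSet {s(.inr e₁, .inr e₂)}).Walk x y →
      ∀ a, x = .inr a → ∃ b, y = .inr b ∧ (U \ fromEdgeSet {s(e₁, e₂)}).Reachable a b := by
    intro e₁ e₂ x y w
    induction w with
    | nil => exact fun a h => ⟨a, h, Reachable.refl _⟩
    | @cons u v w' h p ih =>
      rintro a rfl
      rcases v with v | v
      · simp [sdiff_adj] at h
      · obtain ⟨b, hb, hr⟩ := ih v rfl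
        refine ⟨b, hb, Reachable.trans (Adj.reachable ?_) hr⟩
        simpa [sdiff_adj] using h
  rintro (u | u) (v | v) h
  · have h := hT (by simpa using h : T.Adj u v)
    rw [isBridge_iff] at *
    rintro ⟨w⟩
    obtain ⟨b, hb, hr⟩ := key₁ u v _ _ w u rfl
    cases hb
    exact h hr
  · simp at h
  · simp at h
  · have h := hU (by simpa using h : U.Adj u v)
    rw [isBridge_iff] at *
    rintro ⟨w⟩
    obtain ⟨b, hb, hr⟩ := key₂ u v _ _ w u rfl
    cases hb
    exact h hr

theorem isTree_joinGraph (hT : T.IsTree) (hU : U.IsTree) (s : ι) (t : κ) :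
    (joinGraph T U s t).IsTree := by
  refine ⟨?_, (isAcyclic_sum hT.2 hU.2).sup_edge_of_not_reachable (not_reachable_sum_inl_inr s t)⟩
  rw [connected_iff_exists_forall_reachable]
  refine ⟨.inl s, ?_⟩
  rintro (v | v)
  · exact (hT.1.preconnected s v).map (joinInl T U s t)
  · exact (joinGraph_adj T U s t).reachable.trans ((hU.1.preconnected t v).map (joinInr T U s t))

end Join

/-! ### Decompositions of a part of a graph -/

variable {V : Type*} {G : SimpleGraph V}

/-- `G[S]` has a tree decomposition over a finite tree, all of whose bags satisfy `P`, and one of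
whose bags contains `B`. -/
def HasDecomposition (G : SimpleGraph V) (P : Set V → Prop) (S B : Set V) : Prop :=
  ∃ (ι : Type) (_ : Finite ι) (T : SimpleGraph ι) (bag : ι → Set V) (t₀ : ι),
    T.IsTree ∧ B ⊆ bag t₀ ∧ (∀ t, P (bag t)) ∧ (∀ t, bag t ⊆ S) ∧ (∀ v ∈ S, ∃ t, v ∈ bag t) ∧
    (∀ u ∈ S, ∀ v ∈ S, G.Adj u v → ∃ t, u ∈ bag t ∧ v ∈ bag t) ∧
    ∀ v, (T.induce {t | v ∈ bag t}).Preconnected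

theorem HasDecomposition.single {P : Set V → Prop} {S : Set V} (hS : P S) :
    HasDecomposition G P S S :=
  ⟨Unit, inferInstance, ⊥, fun _ => S, (), IsTree.of_subsingleton, subset_rfl, fun _ => hS,
    fun _ => subset_rfl, fun _ h => ⟨(), h⟩, fun _ hu _ hv _ => ⟨(), hu, hv⟩,
    fun _ => Preconnected.of_subsingleton⟩

theorem HasDecomposition.mono {P : Set V → Prop} {S B B' : Set V} (h : HasDecomposition G P S B)
    (hB : B' ⊆ B) : HasDecomposition G P S B' := by
  obtain ⟨ι, hι, T, bag, t₀, hT, hB₀, h⟩ := h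
  exact ⟨ι, hι, T, bag, t₀, hT, hB.trans hB₀, h⟩

/-- The new tree edge joins the two root bags. Both contain `S₁ ∩ S₂`, so the two subtrees of a
shared vertex become connected. By `hadj` no edge runs between the private parts, so each edge is
covered by one side. Keeping the root `B₁` allows repeated gluing at the same bag. -/
theorem HasDecomposition.join {P : Set V → Prop} {S₁ S₂ B₁ B₂ : Set V}
    (h₁ : HasDecomposition G P S₁ B₁) (h₂ : HasDecomposition G P S₂ B₂)
    (hB₁ : S₁ ∩ S₂ ⊆ B₁) (hB₂ : S₁ ∩ S₂ ⊆ B₂)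
    (hadj : ∀ u ∈ S₁, ∀ v ∈ S₂, G.Adj u v → u ∈ S₂ ∨ v ∈ S₁) :
    HasDecomposition G P (S₁ ∪ S₂) B₁ := by
  obtain ⟨ι, hι, T, bag, s, hT, hsub, hP, hS, hv, he, hc⟩ := h₁
  obtain ⟨κ, hκ, U, bag', t, hT', hsub', hP', hS', hv', he', hc'⟩ := h₂
  refine ⟨ι ⊕ κ, inferInstance, joinGraph T U s t, Sum.elim bag bag', .inl s,
    isTree_joinGraph hT hT' s t, hsub, ?_, ?_, ?_, ?_, ?_⟩
  · rintro (x | x)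
    exacts [hP x, hP' x]
  · rintro (x | x)
    exacts [(hS x).trans Set.subset_union_left, (hS' x).trans Set.subset_union_right]
  · rintro v (h | h)
    · obtain ⟨x, hx⟩ := hv v h
      exact ⟨.inl x, hx⟩
    · obtain ⟨x, hx⟩ := hv' v h
      exact ⟨.inr x, hx⟩
  · have hl : ∀ u ∈ S₁, ∀ v ∈ S₁, G.Adj u v →
        ∃ x, u ∈ Sum.elim bag bag' x ∧ v ∈ Sum.elim bag bag' x := by
      intro u hu v hv h
      obtain ⟨x, hx⟩ := he u hu v hv h
      exact ⟨.inl x, hx⟩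
    have hr : ∀ u ∈ S₂, ∀ v ∈ S₂, G.Adj u v →
        ∃ x, u ∈ Sum.elim bag bag' x ∧ v ∈ Sum.elim bag bag' x := by
      intro u hu v hv h
      obtain ⟨x, hx⟩ := he' u hu v hv h
      exact ⟨.inr x, hx⟩
    rintro u (hu | hu) v (hv | hv) h
    · exact hl u hu v hv h
    · rcases hadj u hu v hv h with h' | h'
      exacts [hr u h' v hv h, hl u hu v h' h]
    · rcases hadj v hv u hu h.symm with h' | h'
      exacts [hr u hu v h' h, hl u h' v hv h]
    · exact hr u hu v hv h
  · intro v
    set J := (joinGraph T U s t).induce {x | v ∈ Sum.elim bag bag' x}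
    have hl : ∀ x y (hx : v ∈ bag x) (hy : v ∈ bag y), J.Reachable ⟨.inl x, hx⟩ ⟨.inl y, hy⟩ := by
      intro x y hx hy
      exact (hc v ⟨x, hx⟩ ⟨y, hy⟩).map
        (⟨fun z => ⟨.inl z.1, z.2⟩, fun h => (joinInl T U s t).map_adj h⟩ :
          T.induce {x | v ∈ bag x} →g J)
    have hr : ∀ x y (hx : v ∈ bag' x) (hy : v ∈ bag' y), J.Reachable ⟨.inr x, hx⟩ ⟨.inr y, hy⟩ := by
      intro x y hx hy
      exact (hc' v ⟨x, hx⟩ ⟨y, hy⟩).map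
        (⟨fun z => ⟨.inr z.1, z.2⟩, fun h => (joinInr T U s t).map_adj h⟩ :
          U.induce {x | v ∈ bag' x} →g J)
    have hlr : ∀ x y (hx : v ∈ bag x) (hy : v ∈ bag' y), J.Reachable ⟨.inl x, hx⟩ ⟨.inr y, hy⟩ := by
      intro x y hx hy
      have hvs : v ∈ S₁ ∩ S₂ := ⟨hS x hx, hS' y hy⟩
      have hvs₁ := hsub (hB₁ hvs)
      have hvs₂ := hsub' (hB₂ hvs)
      refine (hl x s hx hvs₁).trans (Reachable.trans (Adj.reachable ?_) (hr t y hvs₂ hy))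
      exact joinGraph_adj T U s t
    rintro ⟨x | x, hx⟩ ⟨y | y, hy⟩
    exacts [hl x y hx hy, hlr x y hx hy, (hlr y x hy hx).symm, hr x y hx hy]

/-- Every independent set contained in `A` has at most `k` elements. -/
def IndepLE (G : SimpleGraph V) (A : Set V) (k : ℕ) : Prop :=
  ∀ I : Finset V, (I : Set V) ⊆ A → G.IsIndepSet (I : Set V) → I.card ≤ k

theorem treeIndepNum_le_of_hasDecomposition [Finite V] {k : ℕ} {B : Set V}
    (h : HasDecomposition G (IndepLE G · k) Set.univ B) : treeIndepNum G ≤ k := by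
  obtain ⟨ι, hι, T, bag, t₀, hT, -, hP, -, hv, he, hc⟩ := h
  let D : TreeDecomposition G ι :=
    { tree := T
      isTree := hT
      bag := bag
      exists_mem_bag := fun v => hv v trivial
      exists_edge_bag := fun u v huv => he u trivial v trivial huv
      connected_nodes := fun v => by
        -- `HasDecomposition` asks only for preconnectedness because vertices outside `S` lie in no
        -- bag; here every vertex lies in one.
        obtain ⟨t, ht⟩ := hv v trivial
        have : Nonempty {t | v ∈ bag t} := ⟨⟨t, ht⟩⟩
        exact ⟨hc v⟩ }
  refine (treeIndepNum_le D).trans ?_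
  have : Nonempty ι := ⟨t₀⟩
  refine ciSup_le fun t => ?_
  have := Fintype.ofFinite (bag t)
  obtain ⟨I, hI⟩ := (G.induce (bag t)).exists_isNIndepSet_indepNum
  change (G.induce (bag t)).indepNum ≤ k
  rw [← hI.card_eq, ← Finset.card_map (Function.Embedding.subtype _)]
  refine hP t _ ?_ ?_
  · intro x hx
    simp only [Finset.coe_map, Set.mem_image] at hx
    obtain ⟨y, -, rfl⟩ := hx
    exact y.2
  · intro x hx y hy hxy
    simp only [Finset.coe_map, Set.mem_image] at hx hy
    obtain ⟨x, hx, rfl⟩ := hx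
    obtain ⟨y, hy, rfl⟩ := hy
    exact hI.isIndepSet hx hy (fun h => hxy (by rw [h]))

theorem IndepLE.mono {A B : Set V} {a b : ℕ} (h : IndepLE G A a) (hB : B ⊆ A) (hab : a ≤ b) :
    IndepLE G B b :=
  fun I hI hi => (h I (hI.trans hB) hi).trans hab

theorem IndepLE.union {A B : Set V} {a b : ℕ} (hA : IndepLE G A a) (hB : IndepLE G B b) :
    IndepLE G (A ∪ B) (a + b) := by
  classical
  intro I hI hi
  rw [← Finset.card_filter_add_card_filter_not (s := I) (· ∈ A)]
  refine add_le_add (hA _ ?_ ?_) (hB _ ?_ ?_)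
  · intro x hx
    exact (Finset.mem_filter.1 hx).2
  · exact hi.mono (Finset.coe_subset.2 (Finset.filter_subset _ _))
  · intro x hx
    obtain ⟨hx, hxA⟩ := Finset.mem_filter.1 hx
    exact (hI hx).resolve_left hxA
  · exact hi.mono (Finset.coe_subset.2 (Finset.filter_subset _ _))

theorem indepLE_singleton (v : V) : IndepLE G {v} 1 := by
  intro I hI _
  exact Finset.card_le_one.2 fun a ha b hb => (hI ha).trans (hI hb).symm

/-- The graph obtained from `G` by deleting all edges with an end in `Z`. -/
def cutGraph (G : SimpleGraph V) (Z : Set V) : SimpleGraph V where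
  Adj u v := G.Adj u v ∧ u ∉ Z ∧ v ∉ Z
  symm := ⟨fun _ _ h => ⟨h.1.symm, h.2.2, h.2.1⟩⟩
  loopless := ⟨fun _ h => G.loopless.1 _ h.1⟩

/-- For `r ∉ Z`, the vertex set of the component of `G - Z` that contains `r`. -/
def cutComponent (G : SimpleGraph V) (Z : Set V) (r : V) : Set V :=
  {v | (cutGraph G Z).Reachable r v}

theorem mem_cutComponent_self (Z : Set V) (r : V) : r ∈ cutComponent G Z r := Reachable.refl _

theorem notMem_of_mem_cutComponent {Z : Set V} {r v : V} (hr : r ∉ Z)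
    (h : v ∈ cutComponent G Z r) : v ∉ Z := by
  obtain ⟨w⟩ := h
  induction w with
  | nil => exact hr
  | cons h _ ih => exact ih h.2.2

theorem mem_cutComponent_of_adj {Z : Set V} {r u v : V} (hr : r ∉ Z) (hv : v ∉ Z)
    (h : u ∈ cutComponent G Z r) (huv : G.Adj u v) : v ∈ cutComponent G Z r :=
  Reachable.trans h (Adj.reachable ⟨huv, notMem_of_mem_cutComponent hr h, hv⟩)

/-- If every finite set of vertices is split evenly by the components left after deleting a set of
independence number at most `k`, then every part of the graph has a tree decomposition of
independence number at most `5 * k`. -/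
theorem hasDecomposition_of_separators [Finite V] {k : ℕ} (hk : 1 ≤ k)
    (hsep : ∀ I : Finset V, ∃ Z : Set V, IndepLE G Z k ∧ ∀ r ∉ Z, ∀ J ⊆ I,
      (J : Set V) ⊆ cutComponent G Z r → 2 * J.card ≤ I.card) (S W : Set V) (hWS : W ⊆ S)
    (hW : IndepLE G W (4 * k)) : HasDecomposition G (IndepLE G · (5 * k)) S W := by
  classical
  -- Enlarging `W` inside a fixed `S` lowers the second summand; passing to a component lowers the
  -- first without raising the second.
  induction hn : S.ncard + (S \ W).ncard using Nat.strong_induction_on generalizing S W with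
  | _ n ih =>
  subst hn
  by_cases hWS' : W = S
  · subst hWS'
    exact HasDecomposition.single (hW.mono subset_rfl (by omega))
  by_cases hW' : IndepLE G W (4 * k - 1)
  · obtain ⟨v, hvS, hvW⟩ := Set.exists_of_ssubset (hWS.ssubset_of_ne hWS')
    refine (ih _ ?_ S (W ∪ {v}) (Set.union_subset hWS (by simpa using hvS)) ?_ rfl).mono
      Set.subset_union_left
    · refine Nat.add_lt_add_left (Set.ncard_lt_ncard ?_ (Set.toFinite _)) _
      refine ⟨Set.sdiff_subset_sdiff_right Set.subset_union_left, fun h => ?_⟩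
      exact (h ⟨hvS, hvW⟩).2 (Or.inr rfl)
    · exact (hW'.union (indepLE_singleton v)).mono subset_rfl (by omega)
  -- From here the independence number of `W` is exactly `4 * k`, and a maximum independent set of
  -- `W` is the set to be split.
  obtain ⟨I, hIW, hI, hIk⟩ : ∃ I : Finset V, (I : Set V) ⊆ W ∧ G.IsIndepSet (I : Set V) ∧
      I.card = 4 * k := by
    simp only [IndepLE, not_forall] at hW'
    obtain ⟨I, h₁, h₂, h₃⟩ := hW'
    exact ⟨I, h₁, h₂, le_antisymm (hW I h₁ h₂) (by omega)⟩
  obtain ⟨Z, hZ, hcomp⟩ := hsep I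
  have child : ∀ r ∉ Z, HasDecomposition G (IndepLE G · (5 * k))
      ((cutComponent G Z r ∩ S) ∪ (Z ∩ S)) ((cutComponent G Z r ∩ W) ∪ (Z ∩ S)) := by
    intro r hr
    set C := cutComponent G Z r
    have hIC : 2 * (I.filter (· ∈ C)).card ≤ I.card :=
      hcomp r hr _ (Finset.filter_subset _ _) fun x hx => (Finset.mem_filter.1 hx).2
    have hIZ : (I.filter (· ∈ Z)).card ≤ k :=
      hZ _ (fun x hx => (Finset.mem_filter.1 hx).2)
        (hI.mono (Finset.coe_subset.2 (Finset.filter_subset _ _)))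
    have hsub : (C ∩ S) ∪ (Z ∩ S) ⊆ S :=
      Set.union_subset Set.inter_subset_right Set.inter_subset_right
    -- At most `2 * k` elements of `I` lie in `C` and at most `k` in `Z`, so at least `k` lie in
    -- neither. Since `k ≥ 1`, the new part is a proper subset of `S`.
    have hsplit : I.card ≤ (I.filter (· ∈ C)).card + (I.filter (· ∈ Z)).card +
        (I.filter (fun x => x ∉ C ∧ x ∉ Z)).card := by
      refine (Finset.card_le_card (t := (I.filter (· ∈ C) ∪ I.filter (· ∈ Z)) ∪
        I.filter (fun x => x ∉ C ∧ x ∉ Z)) ?_).trans ?_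
      · intro x hx
        simp only [Finset.mem_union, Finset.mem_filter]
        tauto
      · exact (Finset.card_union_le _ _).trans (Nat.add_le_add_right (Finset.card_union_le _ _) _)
    refine ih _ ?_ _ _ ?_ ?_ rfl
    · refine add_lt_add_of_lt_of_le (Set.ncard_lt_ncard (hsub.ssubset_of_ne ?_) (Set.toFinite _))
        (Set.ncard_le_ncard ?_ (Set.toFinite _))
      · intro h
        have : (I.filter (fun x => x ∉ C ∧ x ∉ Z)).card ≠ 0 := by omega
        obtain ⟨x, hx⟩ := Finset.card_pos.1 (Nat.pos_of_ne_zero this)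
        obtain ⟨hxI, hxC, hxZ⟩ := Finset.mem_filter.1 hx
        have hxS := hWS (hIW hxI)
        rw [← h] at hxS
        rcases hxS with hxS | hxS
        exacts [hxC hxS.1, hxZ hxS.1]
      · rintro x ⟨hx | hx, hx'⟩
        · exact ⟨hx.2, fun hxW => hx' (Or.inl ⟨hx.1, hxW⟩)⟩
        · exact absurd (Or.inr hx) hx'
    · exact Set.union_subset_union_left _ (Set.inter_subset_inter_right _ hWS)
    -- Those `k` or more elements of `I` outside `C ∪ Z` have no neighbours in `C`. They extend any
    -- independent subset of `C ∩ W` to one of `W`, which leaves it at most `4 * k - k` elements.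
    · have : IndepLE G (C ∩ W) (3 * k) := by
        intro J hJ hJi
        have hdisj : Disjoint (I.filter (fun x => x ∉ C ∧ x ∉ Z)) J := by
          rw [Finset.disjoint_left]
          intro x hx hxJ
          exact (Finset.mem_filter.1 hx).2.1 (hJ hxJ).1
        have hcross : ∀ x ∈ I.filter (fun x => x ∉ C ∧ x ∉ Z), ∀ y ∈ J, ¬ G.Adj y x := by
          intro x hx y hy hyx
          obtain ⟨-, hxC, hxZ⟩ := Finset.mem_filter.1 hx
          exact hxC (mem_cutComponent_of_adj hr hxZ (hJ hy).1 hyx)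
        have := hW (I.filter (fun x => x ∉ C ∧ x ∉ Z) ∪ J) ?_ ?_
        · rw [Finset.card_union_of_disjoint hdisj] at this
          omega
        · intro x hx
          rcases Finset.mem_union.1 hx with hx | hx
          · exact hIW (Finset.mem_filter.1 hx).1
          · exact (hJ hx).2
        · intro x hx y hy hxy
          rcases Finset.mem_union.1 hx with hx | hx <;> rcases Finset.mem_union.1 hy with hy | hy
          · exact hI (Finset.mem_filter.1 hx).1 (Finset.mem_filter.1 hy).1 hxy
          · exact fun h => hcross x hx y hy h.symm
          · exact hcross y hy x hx
          · exact hJi hx hy hxy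
      exact (this.union (hZ.mono Set.inter_subset_left le_rfl)).mono subset_rfl (by omega)
  have hbag : HasDecomposition G (IndepLE G · (5 * k)) (W ∪ (Z ∩ S)) (W ∪ (Z ∩ S)) :=
    HasDecomposition.single
      ((hW.union (hZ.mono Set.inter_subset_left le_rfl)).mono subset_rfl (by omega))
  -- The components are attached one representative at a time to the bag `W ∪ (Z ∩ S)`; a
  -- representative of a component already attached changes nothing.
  have main : ∀ R : Finset V, (∀ r ∈ R, r ∉ Z) → HasDecomposition G (IndepLE G · (5 * k))
      ((W ∪ (Z ∩ S)) ∪ {v | v ∈ S ∧ ∃ r ∈ R, v ∈ cutComponent G Z r}) (W ∪ (Z ∩ S)) := by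
    intro R
    induction R using Finset.induction_on with
    | empty => intro _; simpa using hbag
    | insert r R _ ihR =>
      intro hR
      have hrZ := hR r (Finset.mem_insert_self _ _)
      have ihR := ihR fun x hx => hR x (Finset.mem_insert_of_mem hx)
      by_cases hrR : ∃ r' ∈ R, r ∈ cutComponent G Z r'
      · obtain ⟨r', hr', hrr'⟩ := hrR
        convert ihR using 2
        ext v
        simp only [Finset.mem_insert, Set.mem_ofPred_eq]
        constructor
        · rintro ⟨hv, x, rfl | hx, hvx⟩
          · exact ⟨hv, r', hr', Reachable.trans hrr' hvx⟩
          · exact ⟨hv, x, hx, hvx⟩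
        · rintro ⟨hv, x, hx, hvx⟩
          exact ⟨hv, x, Or.inr hx, hvx⟩
      · have hinter : ((W ∪ (Z ∩ S)) ∪ {v | v ∈ S ∧ ∃ r ∈ R, v ∈ cutComponent G Z r}) ∩
            ((cutComponent G Z r ∩ S) ∪ (Z ∩ S)) ⊆ (cutComponent G Z r ∩ W) ∪ (Z ∩ S) := by
          rintro v ⟨(hv | hv) | ⟨hvS, r', hr', hvr'⟩, hv' | hv'⟩
          · exact Or.inl ⟨hv'.1, hv⟩
          · exact Or.inr hv'
          · exact Or.inr hv
          · exact Or.inr hv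
          · exact absurd ⟨r', hr', Reachable.trans hvr' (Reachable.symm hv'.1)⟩ hrR
          · exact Or.inr hv'
        have := ihR.join (child r hrZ) ?_ hinter ?_
        · convert this using 1
          ext v
          simp only [Finset.mem_insert, Set.mem_ofPred_eq, Set.mem_union, Set.mem_inter_iff]
          constructor
          · rintro (h | ⟨hv, x, rfl | hx, hvx⟩)
            · exact Or.inl (Or.inl h)
            · exact Or.inr (Or.inl ⟨hvx, hv⟩)
            · exact Or.inl (Or.inr ⟨hv, x, hx, hvx⟩)
          · rintro ((h | ⟨hv, x, hx, hvx⟩) | (⟨hvx, hv⟩ | h))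
            · exact Or.inl h
            · exact Or.inr ⟨hv, x, Or.inr hx, hvx⟩
            · exact Or.inr ⟨hv, r, Or.inl rfl, hvx⟩
            · exact Or.inl (Or.inr h)
        · exact hinter.trans (Set.union_subset_union_left _ Set.inter_subset_right)
        · rintro u hu v (hv | hv) huv
          · have huS : u ∈ S := by
              rcases hu with (hu | hu) | hu
              exacts [hWS hu, hu.2, hu.1]
            by_cases huZ : u ∈ Z
            · exact Or.inl (Or.inr ⟨huZ, huS⟩)
            · exact Or.inl (Or.inl ⟨mem_cutComponent_of_adj hrZ huZ hv.1 huv.symm, huS⟩)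
          · exact Or.inr (Or.inl (Or.inr hv))
  have := Fintype.ofFinite V
  convert (main (Finset.univ.filter (· ∉ Z)) (by simp)).mono Set.subset_union_left using 1
  ext v
  simp only [Set.mem_union, Set.mem_inter_iff, Set.mem_ofPred_eq, Finset.mem_filter,
    Finset.mem_univ, true_and]
  constructor
  · intro hv
    by_cases hvZ : v ∈ Z
    · exact Or.inl (Or.inr ⟨hvZ, hv⟩)
    · exact Or.inr ⟨hv, v, hvZ, mem_cutComponent_self _ _⟩
  · rintro ((h | h) | h)
    exacts [hWS h, h.2, h.1]

/-! ### Recognising `S_p` and `T_p` -/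

/-- The first `p` terms of the three sequences `f i` are distinct vertices; each sequence induces a
path, and the only edges between two of them join their first terms, which they do if and only if
`b` holds. -/
structure IsTripod (G : SimpleGraph V) (p : ℕ) (b : Prop) (f : Fin 3 → ℕ → V) : Prop where
  injective : ∀ i i' j k, j < p → k < p → f i j = f i' k → i = i' ∧ j = k
  adj_iff : ∀ i j k, j < p → k < p → (G.Adj (f i j) (f i k) ↔ k = j + 1 ∨ j = k + 1)
  adj_iff_of_ne : ∀ i i' j k, i ≠ i' → j < p → k < p →
    (G.Adj (f i j) (f i' k) ↔ b ∧ j = 0 ∧ k = 0)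

theorem graphS_isIndContained {p : ℕ} {f : Fin 3 → ℕ → V} (hf : IsTripod G p False f) (c : V)
    (hc : ∀ i j, j < p → f i j ≠ c) (hc' : ∀ i j, j < p → (G.Adj c (f i j) ↔ j = 0)) :
    (graphS p).IsIndContained G := by
  refine ⟨⟨⟨fun x => x.elim c fun y => f y.1 y.2, ?_⟩, ?_⟩⟩
  · rintro (_ | ⟨i, j⟩) (_ | ⟨i', k⟩) h
    · rfl
    · exact absurd h.symm (hc i' k k.2)
    · exact absurd h (hc i j j.2)
    · obtain ⟨rfl, hjk⟩ := hf.injective i i' j k j.2 k.2 h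
      rw [Fin.ext hjk]
  · rintro (_ | ⟨i, j⟩) (_ | ⟨i', k⟩)
    · simp
    · change G.Adj c (f i' k) ↔ _
      simpa [subdividedClaw] using hc' i' k k.2
    · change G.Adj (f i j) c ↔ _
      simpa [subdividedClaw, G.adj_comm] using hc' i j j.2
    · change G.Adj (f i j) (f i' k) ↔ _
      by_cases h : i = i'
      · subst h
        rw [hf.adj_iff i j k j.2 k.2]
        simp only [subdividedClaw, fromRel_adj, ne_eq, Option.some.injEq, Sigma.mk.injEq,
          heq_eq_eq, true_and, Fin.ext_iff]
        omega
      · rw [hf.adj_iff_of_ne i i' j k h j.2 k.2]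
        simp [subdividedClaw, h, Ne.symm h]

/-- The neighbour of `some y` in `S_p` in the direction of the centre. -/
def clawParent {p : ℕ} (y : (_ : Fin 3) × Fin p) : Option ((_ : Fin 3) × Fin p) :=
  if y.2.val = 0 then none else some ⟨y.1, ⟨y.2.val - 1, by omega⟩⟩

theorem clawParent_eq_some {p : ℕ} {y z : (_ : Fin 3) × Fin p} :
    clawParent y = some z ↔ y.1 = z.1 ∧ y.2.val = z.2.val + 1 := by
  obtain ⟨i, j⟩ := y
  obtain ⟨i', k⟩ := z
  unfold clawParent
  split_ifs with h
  · simp at h ⊢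
    omega
  · simp only [Option.some.injEq, Sigma.mk.injEq, heq_eq_eq, Fin.ext_iff]
    simp at h ⊢
    omega

theorem clawParent_eq_none {p : ℕ} {y : (_ : Fin 3) × Fin p} :
    clawParent y = none ↔ y.2.val = 0 := by
  unfold clawParent
  split_ifs with h <;> simp [h]

theorem graphS_adj_some {p : ℕ} (x : Option ((_ : Fin 3) × Fin p)) (y : (_ : Fin 3) × Fin p) :
    (graphS p).Adj x (some y) ↔ clawParent y = x ∨ ∃ z, x = some z ∧ clawParent z = some y := by
  rcases x with _ | z
  · simp [subdividedClaw, clawParent_eq_none]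
  · obtain ⟨i, j⟩ := y
    obtain ⟨i', k⟩ := z
    simp only [clawParent_eq_some, subdividedClaw, fromRel_adj, ne_eq, Option.some.injEq,
      Sigma.mk.injEq, heq_eq_eq, Fin.ext_iff, exists_eq_left']
    omega

/-- The edges of `S_p` correspond to its vertices other than the centre. -/
noncomputable def clawEdgeEquiv (p : ℕ) : ((_ : Fin 3) × Fin p) ≃ (graphS p).edgeSet :=
  Equiv.ofBijective
    (fun y => ⟨s(clawParent y, some y), (graphS_adj_some _ _).2 (Or.inl rfl)⟩) <| by
    constructor
    · intro y z h
      rcases Sym2.eq_iff.1 (congrArg Subtype.val h) with h | ⟨h₁, h₂⟩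
      · exact Option.some.inj h.2
      · have h₁ := (clawParent_eq_some.1 h₁).2
        have h₂ := (clawParent_eq_some.1 h₂.symm).2
        omega
    · have key : ∀ x y, (graphS p).Adj x (some y) → ∃ z, s(clawParent z, some z) = s(x, some y) := by
        intro x y h
        obtain h | ⟨z, hz, h⟩ := (graphS_adj_some x y).1 h
        · exact ⟨y, by rw [h]⟩
        · exact ⟨z, by rw [h, hz, Sym2.eq_swap]⟩
      rintro ⟨e, he⟩
      induction e with
      | _ x y =>
      rcases y with _ | y
      · rcases x with _ | x
        · exact absurd he ((graphS p).loopless.1 _)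
        · obtain ⟨z, hz⟩ := key none x ((graphS p).symm.1 _ _ he)
          exact ⟨z, Subtype.ext (hz.trans Sym2.eq_swap)⟩
      · obtain ⟨z, hz⟩ := key x y he
        exact ⟨z, Subtype.ext hz⟩

/-- Each edge is indexed by its end farther from the centre, so its ends are `clawParent y` and
`some y`; the alternatives list the ways in which two such pairs can meet. -/
theorem graphT_adj_iff {p : ℕ} (y z : (_ : Fin 3) × Fin p) :
    (graphT p).Adj (clawEdgeEquiv p y) (clawEdgeEquiv p z) ↔
      y ≠ z ∧ (clawParent y = clawParent z ∨ clawParent y = some z ∨ clawParent z = some y) := by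
  rw [lineGraph_adj_iff_exists, (clawEdgeEquiv p).injective.ne_iff]
  refine and_congr_right fun hyz => ?_
  have hmem : ∀ y v, v ∈ ((clawEdgeEquiv p y : (graphS p).edgeSet) : Set (Option _)) ↔
      v = clawParent y ∨ v = some y := fun y v => Sym2.mem_iff
  constructor
  · rintro ⟨v, hv, hv'⟩
    rcases (hmem _ _).1 hv with rfl | rfl <;> rcases (hmem _ _).1 hv' with h | h
    · exact Or.inl h
    · exact Or.inr (Or.inl h)
    · exact Or.inr (Or.inr h.symm)
    · exact absurd (Option.some.inj h) hyz
  · rintro (h | h | h)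
    · exact ⟨_, (hmem _ _).2 (Or.inl rfl), (hmem _ _).2 (Or.inl h)⟩
    · exact ⟨_, (hmem _ _).2 (Or.inl rfl), (hmem _ _).2 (Or.inr h)⟩
    · exact ⟨_, (hmem _ _).2 (Or.inr rfl), (hmem _ _).2 (Or.inl h.symm)⟩

/-- The edges of `S_p` at the centre form a triangle in the line graph, and the edges of each leg
form a path starting at a corner of it. -/
theorem graphT_isIndContained {p : ℕ} {f : Fin 3 → ℕ → V} (hf : IsTripod G p True f) :
    (graphT p).IsIndContained G := by
  have key : ∀ y z : (_ : Fin 3) × Fin p, G.Adj (f y.1 y.2) (f z.1 z.2) ↔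
      (graphT p).Adj (clawEdgeEquiv p y) (clawEdgeEquiv p z) := by
    rintro ⟨i, j⟩ ⟨i', k⟩
    have hpar : clawParent (⟨i, j⟩ : (_ : Fin 3) × Fin p) = clawParent ⟨i', k⟩ ↔
        (j.val = 0 ∧ k.val = 0) ∨ (i = i' ∧ j = k) := by
      rcases h : clawParent (⟨i', k⟩ : (_ : Fin 3) × Fin p) with _ | ⟨i'', l⟩
      · rw [clawParent_eq_none] at h ⊢
        simp only [Fin.ext_iff] at *
        omega
      · rw [clawParent_eq_some] at h ⊢
        simp only [Fin.ext_iff] at *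
        omega
    rw [graphT_adj_iff, hpar, clawParent_eq_some, clawParent_eq_some]
    by_cases h : i = i'
    · subst h
      rw [hf.adj_iff i j k j.2 k.2]
      simp only [ne_eq, Sigma.mk.injEq, heq_eq_eq, true_and, Fin.ext_iff]
      omega
    · rw [hf.adj_iff_of_ne i i' j k h j.2 k.2]
      simp [h, Ne.symm h]
  refine ⟨⟨⟨fun e => f ((clawEdgeEquiv p).symm e).1 ((clawEdgeEquiv p).symm e).2, ?_⟩, ?_⟩⟩
  · intro e e' h
    obtain ⟨h₁, h₂⟩ := hf.injective _ _ _ _ (Fin.isLt _) (Fin.isLt _) h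
    refine (clawEdgeEquiv p).symm.injective ?_
    generalize (clawEdgeEquiv p).symm e = y at *
    generalize (clawEdgeEquiv p).symm e' = z at *
    obtain ⟨i, j⟩ := y
    obtain ⟨i', k⟩ := z
    obtain rfl : i = i' := h₁
    obtain rfl : j = k := Fin.ext h₂
    rfl
  · intro e e'
    have := key ((clawEdgeEquiv p).symm e) ((clawEdgeEquiv p).symm e')
    rwa [Equiv.apply_symm_apply, Equiv.apply_symm_apply] at this

/-! ### Induced paths -/

/-- `v 0, …, v n` is an induced path of `G`. -/
structure IsInducedPath (G : SimpleGraph V) (v : ℕ → V) (n : ℕ) : Prop where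
  injective : ∀ i j, i ≤ n → j ≤ n → v i = v j → i = j
  adj_iff : ∀ i j, i ≤ n → j ≤ n → (G.Adj (v i) (v j) ↔ j = i + 1 ∨ i = j + 1)

theorem isTripod_of_legs {p : ℕ} {b : Prop} {x y z : ℕ → V}
    (hx : IsInducedPath G x (p - 1)) (hy : IsInducedPath G y (p - 1))
    (hz : IsInducedPath G z (p - 1))
    (hxy : ∀ j k, j < p → k < p → x j ≠ y k ∧ (G.Adj (x j) (y k) ↔ b ∧ j = 0 ∧ k = 0))
    (hxz : ∀ j k, j < p → k < p → x j ≠ z k ∧ (G.Adj (x j) (z k) ↔ b ∧ j = 0 ∧ k = 0))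
    (hyz : ∀ j k, j < p → k < p → y j ≠ z k ∧ (G.Adj (y j) (z k) ↔ b ∧ j = 0 ∧ k = 0)) :
    IsTripod G p b ![x, y, z] := by
  have swap : ∀ {x y : ℕ → V},
      (∀ j k, j < p → k < p → x j ≠ y k ∧ (G.Adj (x j) (y k) ↔ b ∧ j = 0 ∧ k = 0)) →
      ∀ j k, j < p → k < p → y j ≠ x k ∧ (G.Adj (y j) (x k) ↔ b ∧ j = 0 ∧ k = 0) := by
    intro x y h j k hj hk
    obtain ⟨h₁, h₂⟩ := h k j hk hj
    exact ⟨h₁.symm, by rw [G.adj_comm, h₂]; tauto⟩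
  have hpath : ∀ i, IsInducedPath G (![x, y, z] i) (p - 1) := by
    intro i
    fin_cases i
    exacts [hx, hy, hz]
  have hne : ∀ i i', i ≠ i' → ∀ j k, j < p → k < p → ![x, y, z] i j ≠ ![x, y, z] i' k ∧
      (G.Adj (![x, y, z] i j) (![x, y, z] i' k) ↔ b ∧ j = 0 ∧ k = 0) := by
    intro i i' h
    fin_cases i <;> fin_cases i'
    exacts [absurd rfl h, hxy, hxz, swap hxy, absurd rfl h, hyz, swap hxz, swap hyz, absurd rfl h]
  refine ⟨fun i i' j k hj hk h => ?_, fun i j k hj hk => ?_, fun i i' j k h hj hk => ?_⟩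
  · by_cases hi : i = i'
    · subst hi
      exact ⟨rfl, (hpath i).injective j k (by omega) (by omega) h⟩
    · exact absurd h (hne i i' hi j k hj hk).1
  · exact (hpath i).adj_iff j k (by omega) (by omega)
  · exact (hne i i' h j k hj hk).2

/-- An induced path that enters the middle of another one from afar creates `S_p` or `T_p`. -/
theorem graphS_or_graphT_of_paths {v q : ℕ → V} {m p : ℕ} (hp : 1 ≤ p) (hv : IsInducedPath G v m)
    (hq : IsInducedPath G q p) (hne : ∀ j ≤ p, ∀ i ≤ m, q j ≠ v i)
    (hqv : ∀ j, 1 ≤ j → j ≤ p → ∀ i ≤ m, ¬ G.Adj (q j) (v i))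
    (hends : ∀ i ≤ m, G.Adj (q 0) (v i) → p ≤ i ∧ i + p ≤ m)
    (hex : ∃ i ≤ m, G.Adj (q 0) (v i)) :
    (graphS p).IsIndContained G ∨ (graphT p).IsIndContained G := by
  classical
  have hex' : ∃ i, i ≤ m ∧ G.Adj (q 0) (v i) := hex
  obtain ⟨a, ⟨ham, haq⟩, hamin⟩ : ∃ a, (a ≤ m ∧ G.Adj (q 0) (v a)) ∧
      ∀ i, i ≤ m → G.Adj (q 0) (v i) → a ≤ i :=
    ⟨Nat.find hex', Nat.find_spec hex', fun i h₁ h₂ => Nat.find_min' hex' ⟨h₁, h₂⟩⟩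
  obtain ⟨b, ⟨hbm, hbq⟩, hbmax⟩ : ∃ b, (b ≤ m ∧ G.Adj (q 0) (v b)) ∧
      ∀ i, i ≤ m → G.Adj (q 0) (v i) → i ≤ b := by
    obtain ⟨i, him, hi⟩ := hex
    refine ⟨Nat.findGreatest (fun i => G.Adj (q 0) (v i)) m, ⟨Nat.findGreatest_le _, ?_⟩, ?_⟩
    · exact Nat.findGreatest_spec (P := fun i => G.Adj (q 0) (v i)) him hi
    · exact fun i him hi => Nat.le_findGreatest him hi
  have hab := hamin b hbm hbq
  have hpa := hends a ham haq
  have hpb := hends b hbm hbq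
  have down : ∀ s, p ≤ s + 1 → s ≤ m → IsInducedPath G (fun j => v (s - j)) (p - 1) := by
    intro s hs hsm
    refine ⟨fun i j hi hj h => ?_, fun i j hi hj => ?_⟩
    · have := hv.injective _ _ (by omega) (by omega) h
      omega
    · rw [hv.adj_iff _ _ (by omega) (by omega)]
      omega
  have up : ∀ s, s + p ≤ m + 1 → IsInducedPath G (fun j => v (s + j)) (p - 1) := by
    intro s hs
    refine ⟨fun i j hi hj h => ?_, fun i j hi hj => ?_⟩
    · have := hv.injective _ _ (by omega) (by omega) h
      omega
    · rw [hv.adj_iff _ _ (by omega) (by omega)]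
      omega
  have tail : ∀ s ≤ 1, IsInducedPath G (fun j => q (s + j)) (p - 1) := by
    intro s hs
    refine ⟨fun i j hi hj h => ?_, fun i j hi hj => ?_⟩
    · have := hq.injective _ _ (by omega) (by omega) h
      omega
    · rw [hq.adj_iff _ _ (by omega) (by omega)]
      omega
  -- With `a` and `b` the first and last neighbours of `q 0` on the path: `b = a` gives `S_p`
  -- centred at `v a`, `b = a + 1` gives `T_p` on the triangle `q 0`, `v a`, `v b`, and `b ≥ a + 2`
  -- gives `S_p` centred at `q 0`. Only the last case discards the vertices between `a` and `b` and
  -- uses `q p`.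
  rcases Nat.lt_or_ge b (a + 2) with hb | hb
  · obtain rfl | rfl : b = a ∨ b = a + 1 := by omega
    · left
      refine graphS_isIndContained (f := ![fun j => v (b - 1 - j), fun j => v (b + 1 + j),
        fun j => q (0 + j)]) (isTripod_of_legs (down _ (by omega) (by omega)) (up _ (by omega))
        (tail 0 (by omega)) ?_ ?_ ?_) (v b) ?_ ?_
      · intro j k hj hk
        refine ⟨fun h => ?_, ?_⟩
        · have := hv.injective _ _ (by omega) (by omega) h
          omega
        · rw [hv.adj_iff _ _ (by omega) (by omega)]
          exact iff_of_false (by omega) (fun h => h.1)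
      · intro j k hj hk
        refine ⟨(hne _ (by omega) _ (by omega)).symm, iff_of_false (fun h => ?_) (fun h => h.1)⟩
        rcases Nat.eq_zero_or_pos k with rfl | hk'
        · have := hamin _ (by omega) h.symm
          omega
        · exact hqv _ (by omega) (by omega) _ (by omega) h.symm
      · intro j k hj hk
        refine ⟨(hne _ (by omega) _ (by omega)).symm, iff_of_false (fun h => ?_) (fun h => h.1)⟩
        rcases Nat.eq_zero_or_pos k with rfl | hk'
        · have := hbmax _ (by omega) h.symm
          omega
        · exact hqv _ (by omega) (by omega) _ (by omega) h.symm
      · intro i j hj h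
        fin_cases i
        · have := hv.injective _ _ (by omega) (by omega) h
          omega
        · have := hv.injective _ _ (by omega) (by omega) h
          omega
        · exact hne _ (by omega) _ (by omega) h
      · intro i j hj
        fin_cases i
        · change G.Adj (v b) (v (b - 1 - j)) ↔ _
          rw [hv.adj_iff _ _ (by omega) (by omega)]
          omega
        · change G.Adj (v b) (v (b + 1 + j)) ↔ _
          rw [hv.adj_iff _ _ (by omega) (by omega)]
          omega
        · change G.Adj (v b) (q (0 + j)) ↔ _
          rcases Nat.eq_zero_or_pos j with rfl | hj'
          · exact iff_of_true hbq.symm rfl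
          · exact iff_of_false (fun h => hqv _ (by omega) (by omega) _ (by omega) h.symm) (by omega)
    · right
      refine graphT_isIndContained (f := ![fun j => v (a - j), fun j => v (a + 1 + j),
        fun j => q (0 + j)]) (isTripod_of_legs (down _ (by omega) (by omega)) (up _ (by omega))
        (tail 0 (by omega)) ?_ ?_ ?_)
      · intro j k hj hk
        refine ⟨fun h => ?_, ?_⟩
        · have := hv.injective _ _ (by omega) (by omega) h
          omega
        · rw [hv.adj_iff _ _ (by omega) (by omega)]
          simp only [true_and]
          omega
      · intro j k hj hk
        refine ⟨(hne _ (by omega) _ (by omega)).symm, fun h => ?_, ?_⟩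
        · rcases Nat.eq_zero_or_pos k with rfl | hk'
          · have := hamin _ (by omega) h.symm
            exact ⟨trivial, by omega, rfl⟩
          · exact absurd h.symm (hqv _ (by omega) (by omega) _ (by omega))
        · rintro ⟨-, rfl, rfl⟩
          exact haq.symm
      · intro j k hj hk
        refine ⟨(hne _ (by omega) _ (by omega)).symm, fun h => ?_, ?_⟩
        · rcases Nat.eq_zero_or_pos k with rfl | hk'
          · have := hbmax _ (by omega) h.symm
            exact ⟨trivial, by omega, rfl⟩
          · exact absurd h.symm (hqv _ (by omega) (by omega) _ (by omega))
        · rintro ⟨-, rfl, rfl⟩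
          exact hbq.symm
  · left
    refine graphS_isIndContained (f := ![fun j => v (a - j), fun j => v (b + j),
      fun j => q (1 + j)]) (isTripod_of_legs (down _ (by omega) (by omega)) (up _ (by omega))
      (tail 1 (by omega)) ?_ ?_ ?_) (q 0) ?_ ?_
    · intro j k hj hk
      refine ⟨fun h => ?_, ?_⟩
      · have := hv.injective _ _ (by omega) (by omega) h
        omega
      · rw [hv.adj_iff _ _ (by omega) (by omega)]
        exact iff_of_false (by omega) (fun h => h.1)
    · intro j k hj hk
      exact ⟨(hne _ (by omega) _ (by omega)).symm, iff_of_false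
        (fun h => hqv _ (by omega) (by omega) _ (by omega) h.symm) (fun h => h.1)⟩
    · intro j k hj hk
      exact ⟨(hne _ (by omega) _ (by omega)).symm, iff_of_false
        (fun h => hqv _ (by omega) (by omega) _ (by omega) h.symm) (fun h => h.1)⟩
    · intro i j hj h
      fin_cases i
      · exact hne _ (by omega) _ (by omega) h.symm
      · exact hne _ (by omega) _ (by omega) h.symm
      · have := hq.injective _ _ (by omega) (by omega) h
        omega
    · intro i j hj
      fin_cases i
      · change G.Adj (q 0) (v (a - j)) ↔ _
        refine ⟨fun h => ?_, fun h => by simpa [h] using haq⟩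
        have := hamin _ (by omega) h
        omega
      · change G.Adj (q 0) (v (b + j)) ↔ _
        refine ⟨fun h => ?_, fun h => by simpa [h] using hbq⟩
        have := hbmax _ (by omega) h
        omega
      · change G.Adj (q 0) (q (1 + j)) ↔ _
        rw [hq.adj_iff _ _ (by omega) (by omega)]
        omega

/-! ### Heavy components -/

/-- The closed neighbourhood of a finite set of vertices. -/
def closedNhd (G : SimpleGraph V) (X : Finset V) : Set V :=
  {v | ∃ x ∈ X, v = x ∨ G.Adj x v}

/-- `C` is connected, it is a component of the graph obtained by deleting the closed neighbourhood
of `X`, and it contains more than half of `I`. -/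
structure IsHeavy (G : SimpleGraph V) (I X : Finset V) (C : Set V) : Prop where
  linked : ∀ D ⊆ C, D.Nonempty → D ≠ C → ∃ v ∈ C, v ∉ D ∧ ∃ w ∈ D, G.Adj v w
  disjoint : ∀ v ∈ C, v ∉ closedNhd G X
  boundary : ∀ w ∈ C, ∀ v, G.Adj v w → v ∈ C ∨ v ∈ closedNhd G X
  heavy : ∃ J ⊆ I, (J : Set V) ⊆ C ∧ I.card < 2 * J.card

theorem linked_cutComponent {Z : Set V} {r : V} {D : Set V} (hD : D ⊆ cutComponent G Z r)
    (hne : D.Nonempty) (hDC : D ≠ cutComponent G Z r) :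
    ∃ v ∈ cutComponent G Z r, v ∉ D ∧ ∃ w ∈ D, G.Adj v w := by
  obtain ⟨x, hx⟩ := hne
  obtain ⟨y, hy, hyD⟩ := Set.exists_of_ssubset (hD.ssubset_of_ne hDC)
  obtain ⟨w⟩ : (cutGraph G Z).Reachable x y := Reachable.trans (Reachable.symm (hD hx)) hy
  obtain ⟨d, -, hd₁, hd₂⟩ := w.exists_boundary_dart D hx hyD
  exact ⟨d.snd, Reachable.trans (hD hd₁) d.adj.reachable, hd₂, d.fst, hd₁, d.adj.1.symm⟩

theorem isHeavy_cutComponent {I X J : Finset V} {r : V} (hr : r ∉ closedNhd G X) (hJI : J ⊆ I)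
    (hJ : (J : Set V) ⊆ cutComponent G (closedNhd G X) r) (hIJ : I.card < 2 * J.card) :
    IsHeavy G I X (cutComponent G (closedNhd G X) r) where
  linked _ hD hne hDC := linked_cutComponent hD hne hDC
  disjoint _ hv := notMem_of_mem_cutComponent hr hv
  boundary _ hw _ hvw := or_iff_not_imp_right.2 fun hv =>
    mem_cutComponent_of_adj hr hv hw hvw.symm
  heavy := ⟨J, hJI, hJ, hIJ⟩

namespace IsHeavy

variable {I X Y : Finset V} {C D : Set V}

/-- Two subsets of `I`, each with more than half of its elements, must intersect. -/
theorem inter_nonempty (hC : IsHeavy G I X C) (hD : IsHeavy G I Y D) : (C ∩ D).Nonempty := by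
  classical
  obtain ⟨J, hJI, hJ, hJc⟩ := hC.heavy
  obtain ⟨J', hJI', hJ', hJc'⟩ := hD.heavy
  have h₁ := Finset.card_union_add_card_inter J J'
  have h₂ := Finset.card_le_card (Finset.union_subset hJI hJI')
  obtain ⟨x, hx⟩ := Finset.card_pos.1 (by omega : 0 < (J ∩ J').card)
  obtain ⟨hx, hx'⟩ := Finset.mem_inter.1 hx
  exact ⟨x, hJ hx, hJ' hx'⟩

theorem nonempty (hC : IsHeavy G I X C) : C.Nonempty :=
  (hC.inter_nonempty hC).mono Set.inter_subset_left

theorem closedNhd_mono (h : X ⊆ Y) : closedNhd G X ⊆ closedNhd G Y :=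
  fun _ ⟨x, hx, hv⟩ => ⟨x, h hx, hv⟩

/-- Otherwise connectedness of `D` gives an edge leaving `C ∩ D` inside `D`. Its outer end is then
in `N[X] ⊆ N[Y]`, which `D` avoids. -/
theorem subset (hC : IsHeavy G I X C) (hD : IsHeavy G I Y D) (hXY : X ⊆ Y) : D ⊆ C := by
  by_contra h
  obtain ⟨v, hvD, hv, w, hw, hvw⟩ := hD.linked (C ∩ D) Set.inter_subset_right
    (hC.inter_nonempty hD) (fun h' => h (h' ▸ Set.inter_subset_left))
  rcases hC.boundary w hw.1 v hvw with hvC | hvX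
  · exact hv ⟨hvC, hvD⟩
  · exact hD.disjoint v hvD (closedNhd_mono hXY hvX)

end IsHeavy

/-! ### Extending induced paths towards heavy components -/

/-- `v 0, …, v n` is an induced path whose last vertex is adjacent to the heavy component `C` of
`G - N[X]`, while its other vertices are not. -/
structure Approaches (G : SimpleGraph V) (I : Finset V) (v : ℕ → V) (n : ℕ) (X : Finset V)
    (C : Set V) : Prop where
  path : IsInducedPath G v n
  isHeavy : IsHeavy G I X C
  notMem : ∀ i ≤ n, v i ∉ C
  not_adj : ∀ i < n, ∀ w ∈ C, ¬ G.Adj (v i) w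
  adj : ∃ w ∈ C, G.Adj (v n) w

theorem IsInducedPath.update {v : ℕ → V} {n : ℕ} (hv : IsInducedPath G v n) {x : V}
    (hx : ∀ i ≤ n, x ≠ v i) (hadj : ∀ i ≤ n, (G.Adj (v i) x ↔ i = n)) :
    IsInducedPath G (Function.update v (n + 1) x) (n + 1) := by
  have hlt : ∀ i ≤ n, Function.update v (n + 1) x i = v i := fun i hi =>
    Function.update_of_ne (by omega) _ _
  refine ⟨fun i j hi hj h => ?_, fun i j hi hj => ?_⟩
  · rcases Nat.le_succ_iff.1 hi with hi | rfl <;> rcases Nat.le_succ_iff.1 hj with hj | rfl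
    · rw [hlt i hi, hlt j hj] at h
      exact hv.injective i j hi hj h
    · rw [hlt i hi, Function.update_self] at h
      exact absurd h.symm (hx i hi)
    · rw [hlt j hj, Function.update_self] at h
      exact absurd h (hx j hj)
    · rfl
  · rcases Nat.le_succ_iff.1 hi with hi | rfl <;> rcases Nat.le_succ_iff.1 hj with hj | rfl
    · rw [hlt i hi, hlt j hj, hv.adj_iff i j hi hj]
    · rw [hlt i hi, Function.update_self, hadj i hi]
      omega
    · rw [hlt j hj, Function.update_self, G.adj_comm, hadj j hj]
      omega
    · simp

open Classical in
-- A neighbour of `v n` in `C` is lost on passing to `D`, so `D` is a proper subset of `C` and some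
-- `x` in `C \ D` is adjacent to `D`. It lies in the new closed neighbourhood but not in `N[X]`,
-- hence is adjacent to `v n`. Earlier path vertices have no neighbours in `C`, so the extended path
-- is induced.
theorem Approaches.step {I X : Finset V} {v : ℕ → V} {n : ℕ} {C D : Set V}
    (h : Approaches G I v n X C) (hD : IsHeavy G I (insert (v n) X) D) :
    D ⊆ C ∧ ∃ x ∈ C,
      Approaches G I (Function.update v (n + 1) x) (n + 1) (insert (v n) X) D := by
  have hDC := h.isHeavy.subset hD (Finset.subset_insert _ _)
  refine ⟨hDC, ?_⟩
  obtain ⟨c, hc, hcn⟩ := h.adj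
  have hvn : ∀ w ∈ D, ¬ G.Adj (v n) w := fun w hw hadj =>
    hD.disjoint w hw ⟨v n, Finset.mem_insert_self _ _, Or.inr hadj⟩
  obtain ⟨x, hxC, hxD, w, hw, hxw⟩ := h.isHeavy.linked D hDC hD.nonempty
    (fun h' => hvn c (h' ▸ hc) hcn)
  have hxv : ∀ i ≤ n, x ≠ v i := fun i hi hx => h.notMem i hi (hx ▸ hxC)
  have hvx : G.Adj (v n) x := by
    rcases hD.boundary w hw x hxw with hx | ⟨y, hy, hxy⟩
    · exact absurd hx hxD
    rcases Finset.mem_insert.1 hy with rfl | hy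
    · exact hxy.resolve_left (hxv n le_rfl)
    · exact absurd ⟨y, hy, hxy⟩ (h.isHeavy.disjoint x hxC)
  have hlt : ∀ i ≤ n, Function.update v (n + 1) x i = v i := fun i hi =>
    Function.update_of_ne (by omega) _ _
  refine ⟨x, hxC, h.path.update hxv ?_, hD, ?_, ?_, w, hw, by simpa using hxw⟩
  · intro i hi
    rcases hi.lt_or_eq with hi | rfl
    · exact iff_of_false (h.not_adj i hi x hxC) hi.ne
    · exact iff_of_true hvx rfl
  · intro i hi
    rcases Nat.le_succ_iff.1 hi with hi | rfl
    · rw [hlt i hi]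
      exact fun hiD => h.notMem i hi (hDC hiD)
    · simpa using hxD
  · intro i hi w hw
    rw [hlt i (by omega)]
    rcases (Nat.lt_succ_iff.1 hi).lt_or_eq with hi | rfl
    · exact h.not_adj i hi w (hDC hw)
    · exact hvn w hw

/-- Start with the one-vertex path `u` and iterate `Approaches.step`; each new vertex of the path
costs one more vertex in `X`. -/
theorem exists_inducedPath_into_heavy {I X : Finset V} {C : Set V} {u : V} {k : ℕ}
    (hbig : ∀ X : Finset V, X.card ≤ k → ∃ C, IsHeavy G I X C) (hC : IsHeavy G I X C)
    (huC : u ∉ C) (hu : ∃ w ∈ C, G.Adj u w) (n : ℕ) (hn : X.card + n ≤ k) :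
    ∃ q : ℕ → V, q 0 = u ∧ IsInducedPath G q n ∧ ∀ j, 1 ≤ j → j ≤ n → q j ∈ C := by
  classical
  suffices h : ∃ q Y D, Y.card ≤ X.card + n ∧ D ⊆ C ∧ q 0 = u ∧ Approaches G I q n Y D ∧
      ∀ j, 1 ≤ j → j ≤ n → q j ∈ C by
    obtain ⟨q, _, _, -, -, h₀, h, hq⟩ := h
    exact ⟨q, h₀, h.path, hq⟩
  induction n with
  | zero =>
    refine ⟨fun _ => u, X, C, by simp, subset_rfl, rfl, ⟨⟨?_, ?_⟩, hC, ?_, ?_, hu⟩, ?_⟩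
    · intro i j hi hj _
      omega
    · intro i j hi hj
      simp only [SimpleGraph.irrefl, false_iff]
      omega
    · exact fun _ _ => huC
    · intro i hi
      omega
    · intro j hj hj'
      omega
  | succ n ih =>
    obtain ⟨q, Y, D, hY, hDC, h₀, h, hq⟩ := ih (by omega)
    have hcard := Finset.card_insert_le (q n) Y
    obtain ⟨E, hE⟩ := hbig (insert (q n) Y) (by omega)
    obtain ⟨hED, x, hx, hx'⟩ := h.step hE
    refine ⟨_, _, E, by omega, hED.trans hDC, ?_, hx', ?_⟩
    · rw [Function.update_of_ne (by omega), h₀]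
    · intro j hj hjn
      rcases Nat.le_succ_iff.1 hjn with hjn | rfl
      · rw [Function.update_of_ne (by omega)]
        exact hq j hj hjn
      · simpa using hDC hx

/-- The indices below `m` of the first `p` and of the last `p` vertices of a path. -/
def endIndices (p m : ℕ) : Finset ℕ :=
  (Finset.range m).filter fun i => i < p ∨ m ≤ i + p

theorem card_endIndices_le (p m : ℕ) : (endIndices p m).card ≤ 2 * p := by
  have : endIndices p m ⊆ Finset.range p ∪ Finset.Ico (m - p) m := by
    intro i hi
    simp only [endIndices, Finset.mem_filter, Finset.mem_range, Finset.mem_union,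
      Finset.mem_Ico] at hi ⊢
    omega
  refine (Finset.card_le_card this).trans ((Finset.card_union_le _ _).trans ?_)
  simp only [Finset.card_range, Nat.card_Ico]
  omega

open Classical in
-- The set of deleted centres stays bounded while the path grows: only the ends of `v 0, …, v m` are
-- used, and the tip `v (m + 1)` is not yet among them.
theorem exists_approaches {I : Finset V} {p : ℕ} (hp : 1 ≤ p)
    (hS : ¬ (graphS p).IsIndContained G) (hT : ¬ (graphT p).IsIndContained G)
    (hbig : ∀ X : Finset V, X.card ≤ 3 * p + 1 → ∃ C, IsHeavy G I X C) (m : ℕ) :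
    ∃ v C, Approaches G I v (m + 1) ((endIndices p (m + 1)).image v) C := by
  induction m with
  | zero =>
    obtain ⟨C, hC⟩ := hbig ∅ (by simp)
    obtain ⟨x, hx⟩ := hC.nonempty
    obtain ⟨D, hD⟩ := hbig {x} (by simp)
    have hxD : x ∉ D := fun h => hD.disjoint x h ⟨x, by simp, Or.inl rfl⟩
    obtain ⟨y, hyC, hyD, w, hw, hyw⟩ := hC.linked D (hC.subset hD (Finset.empty_subset _))
      hD.nonempty (fun h => hxD (h ▸ hx))
    have hxw : ¬ G.Adj x w := fun h => hD.disjoint w hw ⟨x, by simp, Or.inr h⟩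
    have hyx : y ≠ x := fun h => hxw (h ▸ hyw)
    have hxy : G.Adj x y := by
      rcases hD.boundary w hw y hyw with h | ⟨z, hz, h⟩
      · exact absurd h hyD
      · obtain rfl := Finset.mem_singleton.1 hz
        exact h.resolve_left hyx
    have hend : (endIndices p (0 + 1)).image (fun i => if i = 0 then x else y) = {x} := by
      have : endIndices p (0 + 1) = {0} := by
        ext i
        simp only [endIndices, Finset.mem_filter, Finset.mem_range, Finset.mem_singleton]
        omega
      simp [this]
    refine ⟨fun i => if i = 0 then x else y, D, ⟨?_, ?_⟩, hend ▸ hD, ?_, ?_, w, hw,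
      by simpa using hyw⟩
    · intro i j hi hj h
      obtain rfl | rfl : i = 0 ∨ i = 1 := by omega
      all_goals obtain rfl | rfl : j = 0 ∨ j = 1 := by omega
      all_goals simp_all [hyx.symm]
    · intro i j hi hj
      obtain rfl | rfl : i = 0 ∨ i = 1 := by omega
      all_goals obtain rfl | rfl : j = 0 ∨ j = 1 := by omega
      all_goals simp [hxy, hxy.symm]
    · intro i hi
      split_ifs
      exacts [hxD, hyD]
    · intro i hi w hw h
      obtain rfl : i = 0 := by omega
      exact hD.disjoint w hw ⟨x, by simp, Or.inr (by simpa using h)⟩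
  | succ m ih =>
    obtain ⟨v, C, h⟩ := ih
    set Y := (endIndices p (m + 1)).image v
    have hY : Y.card ≤ 2 * p := Finset.card_image_le.trans (card_endIndices_le _ _)
    have hY' := Finset.card_insert_le (v (m + 1)) Y
    obtain ⟨D, hD⟩ := hbig (insert (v (m + 1)) Y) (by omega)
    obtain ⟨hDC, x, hx, hx'⟩ := h.step hD
    -- The same `D` must be a component for the smaller set of centres, from which the old vertices
    -- that are no longer near an end have been dropped. Connectedness and heaviness do not involve
    -- that set.
    refine ⟨_, D, hx'.path, ⟨hD.linked, ?_, ?_, hD.heavy⟩, hx'.notMem, hx'.not_adj, hx'.adj⟩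
    · rintro w hw ⟨y, hy, hwy⟩
      obtain ⟨i, hi, rfl⟩ := Finset.mem_image.1 hy
      simp only [endIndices, Finset.mem_filter, Finset.mem_range] at hi
      rcases hwy with rfl | hwy
      · exact hx'.notMem i (by omega) hw
      · exact hx'.not_adj i (by omega) w hw hwy
    · intro w hw u huw
      by_contra hu
      rw [not_or] at hu
      have hlt : ∀ i ≤ m + 1, Function.update v (m + 1 + 1) x i = v i := fun i hi =>
        Function.update_of_ne (by omega) _ _
      have huv : ∀ i ≤ m + 1, u ≠ v i := by
        rintro i hi rfl
        exact hx'.not_adj i (by omega) w hw (by rwa [hlt i hi])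
      have hvD : ∀ i ≤ m + 1, ∀ z ∈ D, ¬ G.Adj z (v i) := fun i hi z hz hzv =>
        hx'.not_adj i (by omega) z hz (by rw [hlt i hi]; exact hzv.symm)
      -- A neighbour `u` of `D` that breaks the boundary condition sees the path only at distance at
      -- least `p` from both ends. The `2 * p + 1` centres and the `p` further steps into `D` use up
      -- the budget `3 * p + 1`.
      obtain ⟨q, hq₀, hq, hqD⟩ := exists_inducedPath_into_heavy hbig hD hu.1 ⟨w, hw, huw⟩ p
        (by omega)
      refine (graphS_or_graphT_of_paths hp h.path hq ?_ ?_ ?_ ?_).elim hS hT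
      · intro j hj i hi
        rcases Nat.eq_zero_or_pos j with rfl | hj'
        · rw [hq₀]
          exact huv i hi
        · intro hji
          refine hx'.notMem i (by omega) ?_
          rw [hlt i hi, ← hji]
          exact hqD j hj' hj
      · exact fun j hj hj' i hi => hvD i hi _ (hqD j hj hj')
      · intro i hi hui
        by_contra hcon
        refine hu.2 ⟨v i, Finset.mem_image.2 ⟨i, ?_, hlt i hi⟩, Or.inr (hq₀ ▸ hui.symm)⟩
        simp only [endIndices, Finset.mem_filter, Finset.mem_range]
        omega
      · rw [hq₀]
        rcases hD.boundary w hw u huw with hu' | ⟨y, hy, hyu⟩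
        · exact absurd hu' hu.1
        rcases Finset.mem_insert.1 hy with rfl | hy
        · exact ⟨m + 1, le_rfl, (hyu.resolve_left (huv _ le_rfl)).symm⟩
        · obtain ⟨i, hi, rfl⟩ := Finset.mem_image.1 hy
          simp only [endIndices, Finset.mem_filter, Finset.mem_range] at hi
          exact ⟨i, by omega, (hyu.resolve_left (huv i (by omega))).symm⟩

/-- In a graph without induced `S_p` and `T_p`, every finite set of vertices is split evenly by the
components left after deleting the closed neighbourhood of at most `3 * p + 1` vertices. -/
theorem exists_balanced_separator [Finite V] {p : ℕ} (hp : 1 ≤ p)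
    (hS : ¬ (graphS p).IsIndContained G) (hT : ¬ (graphT p).IsIndContained G) (I : Finset V) :
    ∃ X : Finset V, X.card ≤ 3 * p + 1 ∧ ∀ r ∉ closedNhd G X, ∀ J ⊆ I,
      (J : Set V) ⊆ cutComponent G (closedNhd G X) r → 2 * J.card ≤ I.card := by
  by_contra! hcon
  have hbig : ∀ X : Finset V, X.card ≤ 3 * p + 1 → ∃ C, IsHeavy G I X C := by
    intro X hX
    obtain ⟨r, hr, J, hJI, hJ, hIJ⟩ := hcon X hX
    exact ⟨_, isHeavy_cutComponent hr hJI hJ hIJ⟩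
  -- This length already forces more distinct vertices than `V` has.
  obtain ⟨v, C, h⟩ := exists_approaches hp hS hT hbig (Nat.card V)
  have hinj : Function.Injective fun i : Fin (Nat.card V + 1) => v i := by
    intro i j hij
    exact Fin.ext (h.path.injective i j (by omega) (by omega) hij)
  have := Nat.card_le_card_of_injective _ hinj
  simp at this

/-! ### Stars -/

theorem IndepLE.neighborSet {d : ℕ}
    (hK : ¬ (completeBipartiteGraph (Fin 1) (Fin d)).IsIndContained G) (x : V) :
    IndepLE G {v | G.Adj x v} (d - 1) := by
  intro J hJ hi
  by_contra hcard
  obtain ⟨f⟩ : Nonempty (Fin d ↪ J) := by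
    rw [Function.Embedding.nonempty_iff_card_le]
    simp only [Fintype.card_fin, Fintype.card_coe]
    omega
  have hadj : ∀ i, G.Adj x (f i) := fun i => hJ (f i).2
  refine hK ⟨⟨⟨Sum.elim (fun _ => x) (fun i => (f i : V)), ?_⟩, ?_⟩⟩
  · rintro (i | i) (j | j) h
    · rw [Subsingleton.elim i j]
    · exact absurd h (hadj j).ne
    · exact absurd h.symm (hadj i).ne
    · rw [f.injective (Subtype.ext h)]
  · rintro (i | i) (j | j)
    · exact iff_of_false (G.loopless.1 x) (by simp)
    · exact iff_of_true (hadj j) (by simp)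
    · exact iff_of_true (hadj i).symm (by simp)
    · exact iff_of_false (fun h => hi (f i).2 (f j).2 (G.ne_of_adj h) h) (by simp)

theorem IndepLE.closedNhd {d : ℕ} (hd : 2 ≤ d)
    (hK : ¬ (completeBipartiteGraph (Fin 1) (Fin d)).IsIndContained G) (X : Finset V) :
    IndepLE G (closedNhd G X) (X.card * (d - 1)) := by
  classical
  induction X using Finset.induction_on with
  | empty =>
    intro J hJ _
    rw [Finset.eq_empty_of_forall_notMem (s := J) fun x hx => by
      obtain ⟨y, hy, -⟩ := hJ hx
      simp at hy]
    simp
  | insert x X hx ih =>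
    have hball : IndepLE G {v | v = x ∨ G.Adj x v} (d - 1) := by
      intro J hJ hi
      -- An independent set containing `x` is just `{x}`; here `d ≥ 2` gives `1 ≤ d - 1`.
      by_cases hxJ : x ∈ J
      · have : J ⊆ {x} := fun y hy => Finset.mem_singleton.2 <| (hJ hy).resolve_right fun h =>
          hi hxJ hy h.ne h
        have := Finset.card_le_card this
        simp at this
        omega
      · refine IndepLE.neighborSet hK x J (fun y hy => (hJ hy).resolve_left ?_) hi
        rintro rfl
        exact hxJ hy
    rw [Finset.card_insert_of_notMem hx, add_mul, one_mul]
    refine (ih.union hball).mono ?_ le_rfl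
    rintro v ⟨y, hy, hv⟩
    rcases Finset.mem_insert.1 hy with rfl | hy
    exacts [Or.inr hv, Or.inl ⟨y, hy, hv⟩]

end TreeAlpha

theorem mainTheorem2 {V : Type*} [Finite V] (G : SimpleGraph V) (d p : ℕ)
    (hd : 2 ≤ d) (hp : 1 ≤ p)
    (hK : ¬ (completeBipartiteGraph (Fin 1) (Fin d)).IsIndContained G)
    (hS : ¬ (TreeAlpha.graphS p).IsIndContained G)
    (hT : ¬ (TreeAlpha.graphT p).IsIndContained G) :
    TreeAlpha.treeIndepNum G ≤ 20 * (d - 1) ^ 4 * (p + 1) := by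
  have hd' : 1 ≤ d - 1 := by omega
  have key := TreeAlpha.hasDecomposition_of_separators (G := G) (k := (3 * p + 1) * (d - 1))
    (Nat.mul_pos (by omega) hd') (fun I => by
      obtain ⟨X, hX, hXI⟩ := TreeAlpha.exists_balanced_separator hp hS hT I
      exact ⟨_, (TreeAlpha.IndepLE.closedNhd hd hK X).mono subset_rfl
        (Nat.mul_le_mul_right _ hX), hXI⟩)
    Set.univ ∅ (Set.empty_subset _) (by
      intro I hI _
      rw [Finset.coe_eq_empty.1 (Set.subset_empty_iff.1 hI)]
      simp)
  -- The argument yields `5 * (3 * p + 1) * (d - 1)`, linear in `d - 1`; the fourth power is slack.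
  refine (TreeAlpha.treeIndepNum_le_of_hasDecomposition key).trans ?_
  calc 5 * ((3 * p + 1) * (d - 1)) ≤ 5 * (4 * (p + 1) * (d - 1)) := by gcongr; omega
    _ = 20 * (d - 1) * (p + 1) := by ring
    _ ≤ 20 * (d - 1) ^ 4 * (p + 1) := by
      gcongr
      exact le_self_pow₀ hd' (by norm_num)
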